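/- Let $V$ be a finite-dimensional real vector space, and write $[S]$ for the convex hull of a finite set $S$. An ordered $p$-complex in $V$, where $\dim V=p$, is a family $X=(X_\alpha,\prec_\alpha)_{\alpha\in\mathfrak I}$ with an arbitrary index set $\mathfrak I$. Here each $X_\alpha\subset V$ is a $p$-simplex, that is, the convex hull of a set $\mathrm{Vt}(X_\alpha)$ of $p+1$ affinely independent points, and $\prec_\alpha$ is a strict total order on $\mathrm{Vt}(X_\alpha)$. The point set $\bigcup_\alpha X_\alpha$ is also denoted by $X$. For $x\in X_\alpha$, let $\mathrm{SpVt}(x;X_\alpha)$ be the set of vertices of $X_\alpha$ at which the barycentric coordinate of $x$ is positive. Let $\Lambda\subset V$ be a full lattice, i.e. a discrete subgroup with $\mathbb R\Lambda=V$. An ordered $p$-complex $X$ in $V$ is called a $\Lambda$-complex if the following hold. (i) For all $\alpha,\beta\in\mathfrak I$, the set $X_\alpha\cap X_\beta$ is empty or equal to $[\mathrm{Vt}(X_\alpha)\cap\mathrm{Vt}(X_\beta)]$. (ii) For all $\alpha,\beta\in\mathfrak I$ and $v,w\in\mathrm{Vt}(X_\alpha)\cap\mathrm{Vt}(X_\beta)$: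 $v\prec_\alpha w\iff v\prec_\beta w$. (iii) If $\lambda\in\Lambda$, $v,w\in\mathrm{Vt}(X_\alpha)$ and $v+\lambda,w+\lambda\in\mathrm{Vt}(X_{\alpha'})$, then $v\prec_\alpha w\iff v+\lambda\prec_{\alpha'}w+\lambda$. (iv) The quotient map $V\to V/\Lambda$ is surjective when restricted to $X$, and injective when restricted to the union of the interiors of the $X_\alpha$. (v) If $x\in X_\alpha$, $x'\in X_{\alpha'}$ and $x'=x+\lambda$ with $\lambda\in\Lambda$, then $\mathrm{SpVt}(x';X_{\alpha'})=\mathrm{SpVt}(x;X_\alpha)+\lambda$. (By (i), $\mathrm{SpVt}(x;X_\alpha)$ does not depend on the choice of $X_\alpha\ni x$.) Now let $X=(X_\alpha,\prec_\alpha)_{\alpha\in\mathfrak I}$ be an ordered $p$-complex in $V$, let $\omega:V\to\mathbb R$ be a linear function, and let $M_1<M_2$ be integers. Let $A:V\to(0,1]$ be the upper fractional part of $\omega$, i.e. $A(u)-\omega(u)\in\mathbb Z$ and $0<A(u)\le1$. For $u,u'\in\mathrm{Vt}(X_\alpha)$, put $u\prec^A_\alpha u'$ if $A(u)<A(u')$,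 or if $A(u)=A(u')$ and $u\prec_\alpha u'$. Let $$J:=\{(\alpha,v,\ell)\mid \alpha\in\mathfrak I,\ v\in\mathrm{Vt}(X_\alpha),\ \ell\in\mathbb Z,\ M_1\le\ell<M_2\}.$$ For $\gamma=(\alpha,v,\ell)\in J$, write $\mathrm{Vt}(X_\alpha)=\{v_0,\dots,v_p\}$ with $v_0\prec^A_\alpha\cdots\prec^A_\alpha v_p$, let $v=v_j$, and define $Y_\gamma\subset V\times\mathbb R$ as the convex hull of the points $$\big(v_i,\,A(v_i)-\omega(v_i)+\ell\big)\quad(0\le i\le j),\qquad \big(v_i,\,A(v_i)-\omega(v_i)+\ell-1\big)\quad(j\le i\le p).$$ Take these points as the vertices of $Y_\gamma$, ordered by: $(s,t)\prec_\gamma(s',t')$ if and only if $s\prec_\alpha s'$, or $s=s'$ and $t'<t$. Let $Y(X,\omega,[M_1,M_2]):=(Y_\gamma,\prec_\gamma)_{\gamma\in J}$. **Proposition.** Let $\Lambda\subset V$ be a full lattice in a $p$-dimensional real vector space $V$, let $X$ be a $\Lambda$-complex in $V$, let $M_1<M_2$ be integers, and let $\omega:V\to\mathbb R$ be a linear function.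 Then $Y(X,\omega,[M_1,M_2])$ is an ordered $(p+1)$-complex in $V\times\mathbb R$, and it is a $\big(\Lambda\times(M_2-M_1)\mathbb Z\big)$-complex. Furthermore, for every $\gamma=(\alpha,v,\ell)\in J$ and every $\kappa=(s,t)\in Y_\gamma$, $$A(v)+\ell-1\le\omega(s)+t\le A(v)+\ell.$$ -/

import Mathlib

/-- A family of simplices in a real vector space, recorded by the finite vertex set `vt α` of each
simplex together with a relation `lt α` ("precedes"), of which only the restriction to `vt α`
matters.  The conditions that make it an ordered complex are in `IsOrderedComplex`. -/
structure SimplexFamily (ι V : Type*) where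
  /-- the vertex set of the simplex with index `α` -/
  vt : ι → Finset V
  /-- the strict order on the vertices of the simplex with index `α` -/
  lt : ι → V → V → Prop

namespace SimplexFamily

variable {ι V : Type*} [NormedAddCommGroup V] [NormedSpace ℝ V]

/-- The simplex with index `α`, as a point set: the convex hull of its vertices. -/
def simplex (X : SimplexFamily ι V) (α : ι) : Set V :=
  convexHull ℝ (X.vt α : Set V)

/-- The underlying point set of the family. -/
def pointSet (X : SimplexFamily ι V) : Set V :=
  ⋃ α, X.simplex α

/-- The spanning vertices of `x` in the simplex with index `α`: the vertices whose barycentric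
coordinate at `x` is positive.  (Barycentric coordinates are unique when the vertices are
affinely independent.) -/
def spVt (X : SimplexFamily ι V) (α : ι) (x : V) : Set V :=
  {v | v ∈ X.vt α ∧ ∃ t : V → ℝ, (∀ w ∈ X.vt α, 0 ≤ t w) ∧ ∑ w ∈ X.vt α, t w = 1 ∧
    ∑ w ∈ X.vt α, t w • w = x ∧ 0 < t v}

/-- `X` is an ordered `p`-complex: the ambient space is `p`-dimensional, every member of the family
is a `p`-simplex, and every vertex set carries a (strict) total order. -/
structure IsOrderedComplex (p : ℕ) (X : SimplexFamily ι V) : Prop where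
  finiteDimensional : FiniteDimensional ℝ V
  finrank_eq : Module.finrank ℝ V = p
  card_vt : ∀ α, (X.vt α).card = p + 1
  affineIndependent : ∀ α, AffineIndependent ℝ (fun v : X.vt α => (v : V))
  irrefl : ∀ α, ∀ v ∈ X.vt α, ¬ X.lt α v v
  trans : ∀ α, ∀ u ∈ X.vt α, ∀ v ∈ X.vt α, ∀ w ∈ X.vt α,
    X.lt α u v → X.lt α v w → X.lt α u w
  total : ∀ α, ∀ v ∈ X.vt α, ∀ w ∈ X.vt α, v ≠ w → X.lt α v w ∨ X.lt α w v

/-- A full lattice: a discrete subgroup whose real span is the whole space. -/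
structure IsFullLattice (Λ : AddSubgroup V) : Prop where
  discrete : DiscreteTopology Λ
  span_eq_top : Submodule.span ℝ (Λ : Set V) = ⊤

/-- `X` is a `Λ`-complex (of dimension `p`). -/
structure IsLambdaComplex (p : ℕ) (Λ : AddSubgroup V) (X : SimplexFamily ι V) : Prop where
  isFullLattice : IsFullLattice Λ
  isOrderedComplex : X.IsOrderedComplex p
  /-- (i) simplices meet along common faces -/
  simplicial : ∀ α β, X.simplex α ∩ X.simplex β = ∅ ∨
    X.simplex α ∩ X.simplex β = convexHull ℝ ((X.vt α : Set V) ∩ (X.vt β : Set V))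
  /-- (ii) the orders are compatible -/
  compatible : ∀ α β, ∀ v w, v ∈ X.vt α → v ∈ X.vt β → w ∈ X.vt α → w ∈ X.vt β →
    (X.lt α v w ↔ X.lt β v w)
  /-- (iii) the orders are `Λ`-invariant -/
  invariant : ∀ α α', ∀ v w, ∀ l ∈ Λ, v ∈ X.vt α → w ∈ X.vt α →
    v + l ∈ X.vt α' → w + l ∈ X.vt α' → (X.lt α v w ↔ X.lt α' (v + l) (w + l))
  /-- (iv) first half: `X` surjects onto the quotient by `Λ` -/
  surjOn : Set.SurjOn (QuotientAddGroup.mk : V → V ⧸ Λ) X.pointSet Set.univ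
  /-- (iv) second half: the union of the interiors injects into the quotient by `Λ` -/
  injOn : Set.InjOn (QuotientAddGroup.mk : V → V ⧸ Λ) (⋃ α, interior (X.simplex α))
  /-- (v) the spanning vertices are `Λ`-equivariant -/
  equivariant : ∀ α α', ∀ x ∈ X.simplex α, ∀ x' ∈ X.simplex α', ∀ l ∈ Λ, x' = x + l →
    X.spVt α' x' = (fun v => v + l) '' X.spVt α x

/-- The upper fractional part of `ω`; see `upperFract_eq_iff`. -/
noncomputable def upperFract (ω : V →ₗ[ℝ] ℝ) (u : V) : ℝ :=
  ω u - ⌈ω u⌉ + 1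

theorem upperFract_eq_iff (ω : V →ₗ[ℝ] ℝ) (u : V) (a : ℝ) :
    upperFract ω u = a ↔ (∃ n : ℤ, a - ω u = n) ∧ 0 < a ∧ a ≤ 1 := by
  unfold upperFract
  constructor
  · rintro rfl
    refine ⟨⟨1 - ⌈ω u⌉, by push_cast; ring⟩, ?_, ?_⟩
    · linarith [Int.ceil_lt_add_one (ω u)]
    · linarith [Int.le_ceil (ω u)]
  · rintro ⟨⟨n, hn⟩, h0, h1⟩
    have h : ⌈ω u⌉ = 1 - n := by
      rw [Int.ceil_eq_iff]
      push_cast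
      constructor <;> linarith
    rw [h]
    push_cast
    linarith

/-- The modified order on the vertices of the simplex with index `α`: compare the upper fractional
parts of `ω` first, and break ties with the given order. -/
def ltA (X : SimplexFamily ι V) (ω : V →ₗ[ℝ] ℝ) (α : ι) (u u' : V) : Prop :=
  upperFract ω u < upperFract ω u' ∨ (upperFract ω u = upperFract ω u' ∧ X.lt α u u')

/-- The index set of the raised complex: triples `(α, v, ℓ)` with `v` a vertex of the simplex with
index `α` and `ℓ` an integer with `M₁ ≤ ℓ < M₂`. -/
structure RaisedIndex (X : SimplexFamily ι V) (M₁ M₂ : ℤ) where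
  α : ι
  v : V
  ℓ : ℤ
  v_mem : v ∈ X.vt α
  le_ℓ : M₁ ≤ ℓ
  ℓ_lt : ℓ < M₂

open Classical in
/-- The raised complex.  Write the vertices of the simplex with index `α` as `v₀, …, v_p`,
increasing for `ltA`, and let `v = v_j`.  The vertices of the simplex with index `(α, v, ℓ)` are
`(v_i, A (v_i) - ω (v_i) + ℓ)` for `i ≤ j` and `(v_i, A (v_i) - ω (v_i) + ℓ - 1)` for `j ≤ i`.
They are ordered by their first coordinate, using the original order, and then by decreasing last
coordinate. -/
noncomputable def raise (X : SimplexFamily ι V) (ω : V →ₗ[ℝ] ℝ) (M₁ M₂ : ℤ) :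
    SimplexFamily (X.RaisedIndex M₁ M₂) (V × ℝ) where
  vt γ :=
    ((X.vt γ.α).filter (fun w => X.ltA ω γ.α w γ.v ∨ w = γ.v)).image
        (fun w => (w, upperFract ω w - ω w + γ.ℓ)) ∪
      ((X.vt γ.α).filter (fun w => w = γ.v ∨ X.ltA ω γ.α γ.v w)).image
        (fun w => (w, upperFract ω w - ω w + γ.ℓ - 1))
  lt γ ρ ρ' := X.lt γ.α ρ.1 ρ'.1 ∨ (ρ.1 = ρ'.1 ∧ ρ'.2 < ρ.2)

end SimplexFamily

/-! Fix `x` in a base simplex, with barycentric coordinates `b`, and let `G = ∑ b w * shift ω w` be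
the interpolated value of the integer-valued function `shift ω = A - ω`. Measured from height `G`,
the fibre over `x` of the raised simplex `(α, v, ℓ)` is the interval of length `b v` starting at `ℓ
- 1 + below v`, where `below v` is the total weight of the vertices preceding `v`
(`mem_simplex_raise_iff`). For fixed `ℓ` these intervals tile `[ℓ - 1, ℓ]`, so together they tile
`[M₁ - 1, M₂ - 1]`, a fundamental domain for `(M₂ - M₁)ℤ`. This gives both halves of (iv).

The core is (v). Whether `(w, s)` spans `(x, t)` can be expressed by the integrality of `s`, the
weight `b w` and the average of `relShift w` (`mem_spVt_raise_iff`), without `v` or `ℓ`.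
`Λ`-translation may change fractional parts and hence the modified order, but the resulting integer
jumps cancel in `relShift` (`relShift_translate`). So spanning vertices are equivariant even under
`Λ × ℤ`. Conditions (i) and (ii) are then the zero-translation cases of (v) and (iii). -/

/-! ### Barycentric coordinates, partial sums and product lattices -/

open Classical in
theorem affineIndependent_finset_iff {V : Type*} [AddCommGroup V] [Module ℝ V] {S : Finset V} :
    AffineIndependent ℝ (fun v : S => (v : V)) ↔
      ∀ w : V → ℝ, ∑ v ∈ S, w v = 0 → ∑ v ∈ S, w v • v = 0 → ∀ v ∈ S, w v = 0 := by
  constructor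
  · intro h w h0 h1 v hv
    exact affineIndependent_iff.1 h Finset.univ (fun v => w v)
      (by rw [← h0]; exact Finset.sum_coe_sort S w)
      (by rw [← h1]; exact Finset.sum_coe_sort S (fun v => w v • v)) ⟨v, hv⟩ (Finset.mem_univ _)
  · intro h
    refine affineIndependent_iff.2 fun s w h0 h1 e he => ?_
    set W : V → ℝ := fun v => if hv : v ∈ S then (if (⟨v, hv⟩ : S) ∈ s then w ⟨v, hv⟩ else 0) else 0
      with hW
    have hWe : ∀ e : S, W e = if e ∈ s then w e else 0 := fun e => by simp [hW]
    have := h W (by rw [← Finset.sum_coe_sort S]; simpa [hWe, -Finset.univ_eq_attach] using h0)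
      (by rw [← Finset.sum_coe_sort S]; simpa [hWe, ite_smul, -Finset.univ_eq_attach] using h1) e e.2
    simpa [hWe, he] using this

/-- `b` is a system of barycentric coordinates, supported on `S`, of the point `x`. -/
structure IsBary {V : Type*} [AddCommGroup V] [Module ℝ V] (S : Finset V) (b : V → ℝ) (x : V) :
    Prop where
  nonneg : ∀ w ∈ S, 0 ≤ b w
  sum_eq_one : ∑ w ∈ S, b w = 1
  sum_smul_eq : ∑ w ∈ S, b w • w = x

theorem IsBary.eq {V : Type*} [AddCommGroup V] [Module ℝ V] {S : Finset V} {b c : V → ℝ} {x : V}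
    (hS : AffineIndependent ℝ (fun v : S => (v : V))) (hb : IsBary S b x) (hc : IsBary S c x) :
    ∀ w ∈ S, b w = c w := by
  intro w hw
  have := affineIndependent_finset_iff.1 hS (fun w => b w - c w)
    (by rw [Finset.sum_sub_distrib, hb.sum_eq_one, hc.sum_eq_one, sub_self])
    (by simp only [sub_smul]
        rw [Finset.sum_sub_distrib, hb.sum_smul_eq, hc.sum_smul_eq, sub_self]) w hw
  exact sub_eq_zero.1 this

/-- In a finite set with a strict total order and nonnegative weights of total mass `1`, every
`τ ∈ [0, 1]` lies between two consecutive partial sums of the weights. -/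
theorem exists_partial_sum_interval {V : Type*} {S : Finset V} {r : V → V → Prop}
    [DecidableRel r] (irrefl : ∀ v ∈ S, ¬ r v v)
    (trans : ∀ u ∈ S, ∀ v ∈ S, ∀ w ∈ S, r u v → r v w → r u w)
    (total : ∀ v ∈ S, ∀ w ∈ S, v ≠ w → r v w ∨ r w v) {b : V → ℝ}
    (hb : ∀ v ∈ S, 0 ≤ b v) (hb1 : ∑ v ∈ S, b v = 1) {τ : ℝ} (h0 : 0 ≤ τ) (h1 : τ ≤ 1) :
    ∃ v ∈ S, ∑ u ∈ S with r u v, b u ≤ τ ∧ τ ≤ ∑ u ∈ S with r u v, b u + b v := by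
  classical
  -- The number of predecessors serves as a rank; the required `v` is the vertex of least rank whose
  -- inclusive partial sum reaches `τ`.
  have rank_lt : ∀ u ∈ S, ∀ v ∈ S, r u v →
      (S.filter (r · u)).card < (S.filter (r · v)).card := by
    intro u hu v hv h
    refine Finset.card_lt_card (Finset.ssubset_iff_of_subset ?_ |>.2
      ⟨u, by simp [hu, h], by simp [irrefl u hu]⟩)
    intro w hw
    simp only [Finset.mem_filter] at hw ⊢
    exact ⟨hw.1, trans w hw.1 u hu v hv hw.2 h⟩
  have le_iff : ∀ v ∈ S, S.filter (fun u => r u v ∨ u = v) = insert v (S.filter (r · v)) := by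
    intro v hv
    ext u
    simp only [Finset.mem_filter, Finset.mem_insert]
    constructor
    · tauto
    · rintro (rfl | h) <;> tauto
  have sum_le : ∀ v ∈ S, ∑ u ∈ S with r u v ∨ u = v, b u = ∑ u ∈ S with r u v, b u + b v := by
    intro v hv
    rw [le_iff v hv, Finset.sum_insert (by simp [irrefl v hv]), add_comm]
  have exists_max : ∀ Q ⊆ S, Q.Nonempty → ∃ m ∈ Q, ∀ u ∈ Q, r u m ∨ u = m := by
    intro Q hQ hne
    obtain ⟨m, hm, hmax⟩ := Finset.exists_max_image Q (fun u => (S.filter (r · u)).card) hne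
    refine ⟨m, hm, fun u hu => ?_⟩
    by_contra! h
    rcases total u (hQ hu) m (hQ hm) h.2 with h' | h'
    · exact h.1 h'
    · exact absurd (rank_lt m (hQ hm) u (hQ hu) h') (not_lt.2 (hmax u hu))
  have hSne : S.Nonempty := by
    rw [Finset.nonempty_iff_ne_empty]
    rintro rfl
    simp at hb1
  set P := S.filter (fun v => τ ≤ ∑ u ∈ S with r u v ∨ u = v, b u) with hP
  have hPne : P.Nonempty := by
    obtain ⟨m, hm, hmax⟩ := exists_max S (subset_refl _) hSne
    refine ⟨m, Finset.mem_filter.2 ⟨hm, ?_⟩⟩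
    rw [Finset.filter_true_of_mem hmax, hb1]
    exact h1
  obtain ⟨v, hv, hmin⟩ := Finset.exists_min_image P (fun u => (S.filter (r · u)).card) hPne
  have hvS := (Finset.mem_filter.1 hv).1
  refine ⟨v, hvS, ?_, (sum_le v hvS) ▸ (Finset.mem_filter.1 hv).2⟩
  rcases (S.filter (r · v)).eq_empty_or_nonempty with he | hne
  · rw [he]
    simpa using h0
  · obtain ⟨m, hm, hmax⟩ := exists_max _ (Finset.filter_subset _ _) hne
    have hm' := Finset.mem_filter.1 hm
    have hmP : m ∉ P := fun h => absurd (rank_lt m hm'.1 v hvS hm'.2) (not_lt.2 (hmin m h))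
    have : ∑ u ∈ S with r u m ∨ u = m, b u < τ := by
      by_contra! h
      exact hmP (Finset.mem_filter.2 ⟨hm'.1, h⟩)
    refine le_trans (Finset.sum_le_sum_of_subset_of_nonneg ?_ ?_) this.le
    · intro u hu
      exact Finset.mem_filter.2 ⟨(Finset.mem_filter.1 hu).1, hmax u hu⟩
    · intro u hu _
      exact hb u (Finset.mem_filter.1 hu).1

theorem isFullLattice_prod {V : Type*} [NormedAddCommGroup V] [NormedSpace ℝ V]
    {Λ : AddSubgroup V} (hΛ : SimplexFamily.IsFullLattice Λ) {c : ℝ} (hc : c ≠ 0) :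
    SimplexFamily.IsFullLattice (Λ.prod (AddSubgroup.zmultiples c)) := by
  have := hΛ.discrete
  constructor
  · refine DiscreteTopology.of_continuous_injective
      (f := fun x : Λ.prod (AddSubgroup.zmultiples c) =>
        ((⟨x.1.1, x.2.1⟩, ⟨x.1.2, x.2.2⟩) : Λ × AddSubgroup.zmultiples c)) (by fun_prop) ?_
    intro x y h
    simp only [Prod.mk.injEq, Subtype.mk.injEq] at h
    exact Subtype.ext (Prod.ext h.1 h.2)
  · rw [eq_top_iff]
    rintro ⟨x, t⟩ -
    have h1 : (x, (0 : ℝ)) ∈ Submodule.span ℝ (Λ.prod (AddSubgroup.zmultiples c) : Set (V × ℝ)) := by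
      have hx : x ∈ Submodule.span ℝ (Λ : Set V) := hΛ.span_eq_top ▸ Submodule.mem_top
      have : Submodule.span ℝ (Λ : Set V) ≤ (Submodule.span ℝ
          (Λ.prod (AddSubgroup.zmultiples c) : Set (V × ℝ))).comap (LinearMap.inl ℝ V ℝ) :=
        Submodule.span_le.2 fun l hl =>
          Submodule.subset_span ⟨hl, (AddSubgroup.zmultiples c).zero_mem⟩
      exact this hx
    have h2 : ((0 : V), c) ∈ Submodule.span ℝ (Λ.prod (AddSubgroup.zmultiples c) : Set (V × ℝ)) :=
      Submodule.subset_span ⟨Λ.zero_mem, AddSubgroup.mem_zmultiples c⟩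
    have := Submodule.add_mem _ h1 (Submodule.smul_mem _ (t / c) h2)
    simpa [hc] using this

namespace SimplexFamily

variable {ι V : Type*} [NormedAddCommGroup V] [NormedSpace ℝ V]

/-! ### Spanning vertices and translations -/

theorem mem_simplex_iff {X : SimplexFamily ι V} {α : ι} {x : V} :
    x ∈ X.simplex α ↔ ∃ b, IsBary (X.vt α) b x := by
  rw [simplex, Finset.mem_convexHull']
  exact ⟨fun ⟨b, h0, h1, h2⟩ => ⟨b, h0, h1, h2⟩, fun ⟨b, hb⟩ => ⟨b, hb.1, hb.2, hb.3⟩⟩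

theorem mem_spVt_iff {X : SimplexFamily ι V} {α : ι} {x : V} {b : V → ℝ}
    (hX : AffineIndependent ℝ (fun v : X.vt α => (v : V))) (hb : IsBary (X.vt α) b x) {v : V} :
    v ∈ X.spVt α x ↔ v ∈ X.vt α ∧ 0 < b v := by
  constructor
  · rintro ⟨hv, t, h0, h1, h2, h3⟩
    exact ⟨hv, hb.eq hX ⟨h0, h1, h2⟩ v hv ▸ h3⟩
  · rintro ⟨hv, h⟩
    exact ⟨hv, b, hb.1, hb.2, hb.3, h⟩

/-- A point lies in the convex hull of its spanning vertices. -/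
theorem mem_convexHull_spVt {X : SimplexFamily ι V} {α : ι} {x : V} {b : V → ℝ}
    (hX : AffineIndependent ℝ (fun v : X.vt α => (v : V))) (hb : IsBary (X.vt α) b x) :
    x ∈ convexHull ℝ (X.spVt α x) := by
  classical
  have hs : ∀ v ∈ X.vt α, v ∉ (X.vt α).filter (fun v => 0 < b v) → b v = 0 := by
    intro v hv h
    simp only [Finset.mem_filter, not_and, not_lt] at h
    exact le_antisymm (h hv) (hb.nonneg v hv)
  have : X.spVt α x = ((X.vt α).filter (fun v => 0 < b v) : Finset V) := by
    ext v
    rw [mem_spVt_iff hX hb, Finset.mem_coe, Finset.mem_filter]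
  rw [this, Finset.mem_convexHull']
  refine ⟨b, fun y hy => hb.nonneg y (Finset.mem_filter.1 hy).1, ?_, ?_⟩
  · rw [← hb.sum_eq_one]
    exact Finset.sum_subset (Finset.filter_subset _ _) hs
  · rw [← hb.sum_smul_eq]
    exact Finset.sum_subset (Finset.filter_subset _ _) fun v hv h => by rw [hs v hv h, zero_smul]

/-- Barycentric coordinates are equivariant if the spanning vertices are. -/
theorem bary_translate {X : SimplexFamily ι V} {α α' : ι} {x l : V} {b b' : V → ℝ}
    (hX : ∀ α, AffineIndependent ℝ (fun v : X.vt α => (v : V)))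
    (hb : IsBary (X.vt α) b x) (hb' : IsBary (X.vt α') b' (x + l))
    (h : X.spVt α' (x + l) = (fun v => v + l) '' X.spVt α x) :
    ∀ w ∈ X.vt α, 0 < b w → w + l ∈ X.vt α' ∧ b' (w + l) = b w := by
  classical
  have key : ∀ w ∈ X.vt α, 0 < b w → w + l ∈ X.vt α' := fun w hw hpos =>
    ((mem_spVt_iff (hX α') hb').1 (h ▸ ⟨w, (mem_spVt_iff (hX α) hb).2 ⟨hw, hpos⟩, rfl⟩)).1
  set T := (X.vt α).filter (fun v => 0 < b v) with hT
  have hs : ∀ v ∈ X.vt α, v ∉ T → b v = 0 := by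
    intro v hv h
    simp only [hT, Finset.mem_filter, not_and, not_lt] at h
    exact le_antisymm (h hv) (hb.nonneg v hv)
  have hsub : T.image (fun v => v + l) ⊆ X.vt α' := by
    intro v hv
    obtain ⟨w, hw, rfl⟩ := Finset.mem_image.1 hv
    exact key w (Finset.mem_filter.1 hw).1 (Finset.mem_filter.1 hw).2
  -- The positive weights of `x`, carried along by `l` and extended by zero, represent `x + l`;
  -- uniqueness of barycentric coordinates identifies them with `b'`.
  set c : V → ℝ := fun v => if v ∈ T.image (fun v => v + l) then b (v - l) else 0 with hc
  have hcT : ∀ w ∈ T, c (w + l) = b w := by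
    intro w hw
    simp only [hc]
    rw [if_pos (Finset.mem_image_of_mem _ hw), add_sub_cancel_right]
  have hc0 : ∀ v ∈ X.vt α', v ∉ T.image (fun v => v + l) → c v = 0 := fun v _ hv => by
    simp only [hc]
    rw [if_neg hv]
  have hcb : IsBary (X.vt α') c (x + l) := by
    refine ⟨fun v hv => ?_, ?_, ?_⟩
    · by_cases hv' : v ∈ T.image (fun v => v + l)
      · obtain ⟨w, hw, rfl⟩ := Finset.mem_image.1 hv'
        rw [hcT w hw]
        exact (Finset.mem_filter.1 hw).2.le
      · rw [hc0 v hv hv']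
    · rw [← Finset.sum_subset hsub hc0, Finset.sum_image fun _ _ _ _ h => add_right_cancel h,
        Finset.sum_congr rfl hcT, ← hb.sum_eq_one]
      exact Finset.sum_subset (Finset.filter_subset _ _) hs
    · rw [← Finset.sum_subset hsub fun v hv h => by rw [hc0 v hv h, zero_smul],
        Finset.sum_image fun _ _ _ _ h => add_right_cancel h,
        Finset.sum_congr rfl fun w hw => by rw [hcT w hw, smul_add],
        Finset.sum_add_distrib, ← Finset.sum_smul,
        Finset.sum_subset (Finset.filter_subset _ _) hs,
        Finset.sum_subset (Finset.filter_subset _ _) fun v hv h => by rw [hs v hv h, zero_smul],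
        hb.sum_eq_one, hb.sum_smul_eq, one_smul]
  intro w hw hpos
  refine ⟨key w hw hpos, ?_⟩
  rw [hb'.eq (hX α') hcb _ (key w hw hpos), hcT w (Finset.mem_filter.2 ⟨hw, hpos⟩)]

/-- Barycentric averages are invariant under translations for which the spanning vertices are
equivariant. -/
theorem sum_bary_translate {X : SimplexFamily ι V} {α α' : ι} {x l : V} {b b' : V → ℝ}
    (hX : ∀ α, AffineIndependent ℝ (fun v : X.vt α => (v : V)))
    (hb : IsBary (X.vt α) b x) (hb' : IsBary (X.vt α') b' (x + l))
    (h : X.spVt α' (x + l) = (fun v => v + l) '' X.spVt α x) {F F' : V → ℝ}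
    (hF : ∀ w ∈ X.vt α, w + l ∈ X.vt α' → F' (w + l) = F w) :
    ∑ w ∈ X.vt α', b' w * F' w = ∑ w ∈ X.vt α, b w * F w := by
  have tr := bary_translate hX hb hb' h
  symm
  -- Only terms of nonzero weight are matched: the other vertices need not translate to vertices of
  -- the second simplex.
  refine Finset.sum_bij_ne_zero (fun w _ _ => w + l) ?_ ?_ ?_ ?_
  · intro w hw h0
    exact (tr w hw ((hb.nonneg w hw).lt_of_ne' (left_ne_zero_of_mul h0))).1
  · intro _ _ _ _ _ _ h
    exact add_right_cancel h
  · intro v hv h0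
    have hv' : v ∈ X.spVt α' (x + l) := (mem_spVt_iff (hX α') hb').2
      ⟨hv, (hb'.nonneg v hv).lt_of_ne' (left_ne_zero_of_mul h0)⟩
    rw [h] at hv'
    obtain ⟨w, hw, rfl⟩ := hv'
    obtain ⟨hw, hpos⟩ := (mem_spVt_iff (hX α) hb).1 hw
    refine ⟨w, hw, ?_, rfl⟩
    rwa [← hF w hw hv, ← (tr w hw hpos).2]
  · intro w hw h0
    obtain ⟨h1, h2⟩ := tr w hw ((hb.nonneg w hw).lt_of_ne' (left_ne_zero_of_mul h0))
    rw [h2, hF w hw h1]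

/-! ### The modified order and its partial sums -/

theorem IsOrderedComplex.ltA_irrefl {p : ℕ} {X : SimplexFamily ι V} (hX : X.IsOrderedComplex p)
    (ω : V →ₗ[ℝ] ℝ) {α : ι} {v : V} (hv : v ∈ X.vt α) : ¬ X.ltA ω α v v := by
  rintro (h | h)
  · exact lt_irrefl _ h
  · exact hX.irrefl α v hv h.2

theorem IsOrderedComplex.ltA_trans {p : ℕ} {X : SimplexFamily ι V} (hX : X.IsOrderedComplex p)
    (ω : V →ₗ[ℝ] ℝ) {α : ι} {u v w : V} (hu : u ∈ X.vt α) (hv : v ∈ X.vt α) (hw : w ∈ X.vt α)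
    (huv : X.ltA ω α u v) (hvw : X.ltA ω α v w) : X.ltA ω α u w := by
  rcases huv with h | ⟨h, h'⟩ <;> rcases hvw with k | ⟨k, k'⟩
  · exact Or.inl (h.trans k)
  · exact Or.inl (k ▸ h)
  · exact Or.inl (h ▸ k)
  · exact Or.inr ⟨h.trans k, hX.trans α u hu v hv w hw h' k'⟩

theorem IsOrderedComplex.ltA_total {p : ℕ} {X : SimplexFamily ι V} (hX : X.IsOrderedComplex p)
    (ω : V →ₗ[ℝ] ℝ) {α : ι} {v w : V} (hv : v ∈ X.vt α) (hw : w ∈ X.vt α) (hne : v ≠ w) :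
    X.ltA ω α v w ∨ X.ltA ω α w v := by
  rcases lt_trichotomy (upperFract ω v) (upperFract ω w) with h | h | h
  · exact Or.inl (Or.inl h)
  · exact (hX.total α v hv w hw hne).imp (fun k => Or.inr ⟨h, k⟩) (fun k => Or.inr ⟨h.symm, k⟩)
  · exact Or.inr (Or.inl h)

/-- The difference between the upper fractional part and the function itself. -/
noncomputable def shift (ω : V →ₗ[ℝ] ℝ) (w : V) : ℝ := upperFract ω w - ω w

theorem exists_shift_eq (ω : V →ₗ[ℝ] ℝ) (w : V) : ∃ n : ℤ, shift ω w = n :=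
  ((upperFract_eq_iff ω w _).1 rfl).1

theorem upperFract_pos (ω : V →ₗ[ℝ] ℝ) (w : V) : 0 < upperFract ω w :=
  ((upperFract_eq_iff ω w _).1 rfl).2.1

theorem upperFract_le_one (ω : V →ₗ[ℝ] ℝ) (w : V) : upperFract ω w ≤ 1 :=
  ((upperFract_eq_iff ω w _).1 rfl).2.2

open Classical in
/-- The total weight of the vertices strictly below `v`. -/
noncomputable def below (X : SimplexFamily ι V) (ω : V →ₗ[ℝ] ℝ) (α : ι) (b : V → ℝ) (v : V) : ℝ :=
  ∑ u ∈ X.vt α with X.ltA ω α u v, b u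

theorem below_nonneg {X : SimplexFamily ι V} (ω : V →ₗ[ℝ] ℝ) {α : ι} {b : V → ℝ} {x : V}
    (hb : IsBary (X.vt α) b x) (v : V) : 0 ≤ X.below ω α b v := by
  classical
  refine Finset.sum_nonneg fun u hu => ?_
  exact hb.nonneg u (Finset.mem_filter.1 hu).1

/-- The predecessors of `v`, and `v` itself, all precede `w`. Hence the weight intervals of distinct
vertices do not overlap. -/
theorem below_add_le {p : ℕ} {X : SimplexFamily ι V} (hX : X.IsOrderedComplex p)
    (ω : V →ₗ[ℝ] ℝ) {α : ι} {b : V → ℝ} {x : V} (hb : IsBary (X.vt α) b x) {v w : V}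
    (hv : v ∈ X.vt α) (hw : w ∈ X.vt α) (h : X.ltA ω α v w) :
    X.below ω α b v + b v ≤ X.below ω α b w := by
  classical
  rw [below, below, add_comm, ← Finset.sum_insert (by simp [hX.ltA_irrefl ω hv])]
  refine Finset.sum_le_sum_of_subset_of_nonneg ?_
    fun u hu _ => hb.nonneg u (Finset.mem_filter.1 hu).1
  intro u hu
  rcases Finset.mem_insert.1 hu with rfl | hu
  · exact Finset.mem_filter.2 ⟨hv, h⟩
  · have hu := Finset.mem_filter.1 hu
    exact Finset.mem_filter.2 ⟨hu.1, hX.ltA_trans ω hu.1 hv hw hu.2 h⟩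

theorem below_add_le_one {p : ℕ} {X : SimplexFamily ι V} (hX : X.IsOrderedComplex p)
    (ω : V →ₗ[ℝ] ℝ) {α : ι} {b : V → ℝ} {x : V} (hb : IsBary (X.vt α) b x) {v : V}
    (hv : v ∈ X.vt α) : X.below ω α b v + b v ≤ 1 := by
  classical
  rw [below, add_comm, ← Finset.sum_insert (by simp [hX.ltA_irrefl ω hv]), ← hb.sum_eq_one]
  refine Finset.sum_le_sum_of_subset_of_nonneg ?_ fun u hu _ => hb.nonneg u hu
  intro u hu
  rcases Finset.mem_insert.1 hu with rfl | hu
  · exact hv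
  · exact (Finset.mem_filter.1 hu).1

/-! ### Translation invariance of relative heights -/

open Classical in
/-- The height difference of two vertices of a simplex, increased by one if the first one
precedes the second. -/
noncomputable def relShift (X : SimplexFamily ι V) (ω : V →ₗ[ℝ] ℝ) (α : ι) (w u : V) : ℝ :=
  shift ω u - shift ω w + if X.ltA ω α u w then 1 else 0

/-- Writes the offset that locates the weight interval of `w` as a barycentric average, the form to
which `sum_bary_translate` applies. -/
theorem sum_mul_relShift {X : SimplexFamily ι V} (ω : V →ₗ[ℝ] ℝ) {α : ι} {b : V → ℝ} {x : V}
    (hb : IsBary (X.vt α) b x) (w : V) :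
    ∑ u ∈ X.vt α, b u * X.relShift ω α w u =
      ∑ u ∈ X.vt α, b u * shift ω u - shift ω w + X.below ω α b w := by
  classical
  simp only [relShift, mul_add, mul_sub, Finset.sum_add_distrib, Finset.sum_sub_distrib,
    ← Finset.sum_mul, hb.sum_eq_one, one_mul, below, mul_ite, mul_one, mul_zero, Finset.sum_filter]

/-- Since `ω l` cancels, the change in `shift u - shift w` is the change in `A u - A w`, an integer
difference of two numbers in `(-1, 1)`. A jump by `±1` forces these to have opposite signs, so the
indicator of `u` preceding `w` flips and compensates. Without a jump, the comparison and any
tie-break are unchanged. -/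
theorem relShift_translate {X : SimplexFamily ι V} (ω : V →ₗ[ℝ] ℝ) {α α' : ι} {l u w : V}
    (h : X.lt α u w ↔ X.lt α' (u + l) (w + l)) :
    X.relShift ω α' (w + l) (u + l) = X.relShift ω α w u := by
  obtain ⟨i, hi⟩ := exists_shift_eq ω u
  obtain ⟨j, hj⟩ := exists_shift_eq ω w
  obtain ⟨i', hi'⟩ := exists_shift_eq ω (u + l)
  obtain ⟨j', hj'⟩ := exists_shift_eq ω (w + l)
  have u0 := upperFract_pos ω u
  have u1 := upperFract_le_one ω u
  have w0 := upperFract_pos ω w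
  have w1 := upperFract_le_one ω w
  have u0' := upperFract_pos ω (u + l)
  have u1' := upperFract_le_one ω (u + l)
  have w0' := upperFract_pos ω (w + l)
  have w1' := upperFract_le_one ω (w + l)
  have e : ((i - j - (i' - j') : ℤ) : ℝ) = (upperFract ω u - upperFract ω w)
      - (upperFract ω (u + l) - upperFract ω (w + l)) := by
    push_cast
    rw [← hi, ← hj, ← hi', ← hj']
    simp only [shift, map_add]
    ring
  set k : ℤ := i - j - (i' - j') with hk
  have lo : ∀ n : ℤ, (n : ℝ) < k → n + 1 ≤ k := fun n hn => by exact_mod_cast hn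
  have hi2 : ∀ n : ℤ, (k : ℝ) < n → k + 1 ≤ n := fun n hn => by exact_mod_cast hn
  have goal_of : ∀ {s t : ℝ}, (k : ℝ) = t - s →
      shift ω (u + l) - shift ω (w + l) + t = shift ω u - shift ω w + s := by
    intro s t h
    rw [hi, hj, hi', hj']
    rw [hk] at h
    push_cast at h
    linarith
  unfold relShift
  apply goal_of
  -- Here `A u > A w` while `A (u + l) < A (w + l)`; for `k = -1` the signs are reversed.
  by_cases hk1 : k = 1
  · have : (k : ℝ) = 1 := by exact_mod_cast hk1
    rw [if_pos, if_neg, this, sub_zero]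
    · rintro (h' | ⟨h', -⟩) <;> linarith
    · left; linarith
  by_cases hk1 : k = -1
  · have : (k : ℝ) = -1 := by exact_mod_cast hk1
    rw [if_neg, if_pos, this, zero_sub]
    · left; linarith
    · rintro (h' | ⟨h', -⟩) <;> linarith
  have hk0 : k = 0 := by
    have h1 := lo (-2) (by push_cast; linarith)
    have h2 := hi2 2 (by push_cast; linarith)
    omega
  have hk' : (k : ℝ) = 0 := by exact_mod_cast hk0
  have : X.ltA ω α' (u + l) (w + l) ↔ X.ltA ω α u w := by
    rw [hk'] at e
    unfold ltA
    rw [h]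
    constructor
    · rintro (h' | ⟨h', h''⟩)
      · left; linarith
      · right; exact ⟨by linarith, h''⟩
    · rintro (h' | ⟨h', h''⟩)
      · left; linarith
      · right; exact ⟨by linarith, h''⟩
  by_cases h' : X.ltA ω α u w
  · rw [if_pos h', if_pos (this.2 h'), hk', sub_self]
  · rw [if_neg h', if_neg (mt this.1 h'), hk', sub_self]

/-! ### Vertices and weights of raised simplices -/

open Classical in
/-- The height over `w` of the upper boundary of a raised simplex. -/
noncomputable def raisedHeight (X : SimplexFamily ι V) (ω : V →ₗ[ℝ] ℝ) {M₁ M₂ : ℤ}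
    (γ : X.RaisedIndex M₁ M₂) (w : V) : ℝ :=
  shift ω w + γ.ℓ - if X.ltA ω γ.α γ.v w then 1 else 0

theorem raisedHeight_self {p : ℕ} {X : SimplexFamily ι V} (hX : X.IsOrderedComplex p)
    (ω : V →ₗ[ℝ] ℝ) {M₁ M₂ : ℤ} (γ : X.RaisedIndex M₁ M₂) :
    X.raisedHeight ω γ γ.v = shift ω γ.v + γ.ℓ := by
  rw [raisedHeight, if_neg (hX.ltA_irrefl ω γ.v_mem), sub_zero]

open Classical in
-- Only `v` is lifted twice. Separating its lower copy leaves a graph over the base vertices, so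
-- every sum over the raised vertices is a base sum plus one term.
theorem vt_raise {p : ℕ} {X : SimplexFamily ι V} (hX : X.IsOrderedComplex p)
    (ω : V →ₗ[ℝ] ℝ) {M₁ M₂ : ℤ} (γ : X.RaisedIndex M₁ M₂) :
    (X.raise ω M₁ M₂).vt γ = insert (γ.v, shift ω γ.v + γ.ℓ - 1)
      ((X.vt γ.α).image fun w => (w, X.raisedHeight ω γ w)) := by
  ext ⟨w, t⟩
  simp only [raise, Finset.mem_union, Finset.mem_image, Finset.mem_filter, Finset.mem_insert,
    Prod.mk.injEq]
  constructor
  · rintro (⟨u, ⟨hu, h⟩, rfl, rfl⟩ | ⟨u, ⟨hu, h⟩, rfl, rfl⟩)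
    · refine Or.inr ⟨u, hu, rfl, ?_⟩
      rw [raisedHeight, if_neg, sub_zero, shift]
      rcases h with h | rfl
      · exact fun h' => hX.ltA_irrefl ω hu (hX.ltA_trans ω hu γ.v_mem hu h h')
      · exact hX.ltA_irrefl ω hu
    · rcases h with rfl | h
      · exact Or.inl ⟨rfl, rfl⟩
      · refine Or.inr ⟨u, hu, rfl, ?_⟩
        rw [raisedHeight, if_pos h, shift]
  · rintro (⟨rfl, rfl⟩ | ⟨u, hu, rfl, rfl⟩)
    · exact Or.inr ⟨γ.v, ⟨γ.v_mem, Or.inl rfl⟩, rfl, rfl⟩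
    · by_cases h : X.ltA ω γ.α γ.v u
      · refine Or.inr ⟨u, ⟨hu, Or.inr h⟩, rfl, ?_⟩
        rw [raisedHeight, if_pos h, shift]
      · refine Or.inl ⟨u, ⟨hu, ?_⟩, rfl, ?_⟩
        · by_cases he : u = γ.v
          · exact Or.inr he
          · exact Or.inl ((hX.ltA_total ω hu γ.v_mem he).resolve_right h)
        · rw [raisedHeight, if_neg h, sub_zero, shift]

open Classical in
theorem bottom_notMem {p : ℕ} {X : SimplexFamily ι V} (hX : X.IsOrderedComplex p)
    (ω : V →ₗ[ℝ] ℝ) {M₁ M₂ : ℤ} (γ : X.RaisedIndex M₁ M₂) :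
    (γ.v, shift ω γ.v + γ.ℓ - 1) ∉ (X.vt γ.α).image fun w => (w, X.raisedHeight ω γ w) := by
  simp only [Finset.mem_image, Prod.mk.injEq, not_exists, not_and]
  rintro w - rfl
  rw [raisedHeight_self hX]
  linarith

theorem mem_vt_raise {p : ℕ} {X : SimplexFamily ι V} (hX : X.IsOrderedComplex p)
    (ω : V →ₗ[ℝ] ℝ) {M₁ M₂ : ℤ} (γ : X.RaisedIndex M₁ M₂) {w : V} {t : ℝ} :
    (w, t) ∈ (X.raise ω M₁ M₂).vt γ ↔ (w = γ.v ∧ t = shift ω γ.v + γ.ℓ - 1) ∨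
      (w ∈ X.vt γ.α ∧ t = X.raisedHeight ω γ w) := by
  classical
  rw [vt_raise hX]
  simp only [Finset.mem_insert, Finset.mem_image, Prod.mk.injEq]
  refine or_congr_right ⟨?_, fun ⟨h, h'⟩ => ⟨w, h, rfl, h'.symm⟩⟩
  rintro ⟨u, hu, rfl, rfl⟩
  exact ⟨hu, rfl⟩

theorem fst_mem_of_mem_vt_raise {p : ℕ} {X : SimplexFamily ι V} (hX : X.IsOrderedComplex p)
    (ω : V →ₗ[ℝ] ℝ) {M₁ M₂ : ℤ} {γ : X.RaisedIndex M₁ M₂} {ρ : V × ℝ}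
    (h : ρ ∈ (X.raise ω M₁ M₂).vt γ) : ρ.1 ∈ X.vt γ.α := by
  rcases (mem_vt_raise hX ω γ (w := ρ.1) (t := ρ.2)).1 h with h | h
  · exact h.1 ▸ γ.v_mem
  · exact h.1

theorem sum_vt_raise {p : ℕ} {X : SimplexFamily ι V} (hX : X.IsOrderedComplex p)
    (ω : V →ₗ[ℝ] ℝ) {M₁ M₂ : ℤ} (γ : X.RaisedIndex M₁ M₂) {M : Type*} [AddCommMonoid M]
    (f : V × ℝ → M) :
    ∑ ρ ∈ (X.raise ω M₁ M₂).vt γ, f ρ =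
      f (γ.v, shift ω γ.v + γ.ℓ - 1) + ∑ w ∈ X.vt γ.α, f (w, X.raisedHeight ω γ w) := by
  classical
  rw [vt_raise hX, Finset.sum_insert (bottom_notMem hX ω γ),
    Finset.sum_image fun _ _ _ _ h => congrArg Prod.fst h]

theorem card_vt_raise {p : ℕ} {X : SimplexFamily ι V} (hX : X.IsOrderedComplex p)
    (ω : V →ₗ[ℝ] ℝ) {M₁ M₂ : ℤ} (γ : X.RaisedIndex M₁ M₂) :
    ((X.raise ω M₁ M₂).vt γ).card = p + 1 + 1 := by
  classical
  rw [vt_raise hX, Finset.card_insert_of_notMem (bottom_notMem hX ω γ),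
    Finset.card_image_of_injective _ fun _ _ h => congrArg Prod.fst h, hX.card_vt]

open Classical in
/-- The weights on the base simplex induced by weights on the raised simplex. -/
noncomputable def projWeight (X : SimplexFamily ι V) (ω : V →ₗ[ℝ] ℝ) {M₁ M₂ : ℤ}
    (γ : X.RaisedIndex M₁ M₂) (c : V × ℝ → ℝ) (w : V) : ℝ :=
  c (w, X.raisedHeight ω γ w) + if w = γ.v then c (γ.v, shift ω γ.v + γ.ℓ - 1) else 0

theorem sum_projWeight_smul {p : ℕ} {X : SimplexFamily ι V} (hX : X.IsOrderedComplex p)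
    (ω : V →ₗ[ℝ] ℝ) {M₁ M₂ : ℤ} (γ : X.RaisedIndex M₁ M₂) (c : V × ℝ → ℝ) {M : Type*}
    [AddCommGroup M] [Module ℝ M] (f : V → M) :
    ∑ ρ ∈ (X.raise ω M₁ M₂).vt γ, c ρ • f ρ.1 =
      ∑ w ∈ X.vt γ.α, X.projWeight ω γ c w • f w := by
  classical
  rw [sum_vt_raise hX]
  simp only [projWeight, add_smul, Finset.sum_add_distrib, ite_smul, zero_smul,
    Finset.sum_ite_eq', γ.v_mem, if_true]
  exact add_comm _ _

theorem sum_projWeight {p : ℕ} {X : SimplexFamily ι V} (hX : X.IsOrderedComplex p)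
    (ω : V →ₗ[ℝ] ℝ) {M₁ M₂ : ℤ} (γ : X.RaisedIndex M₁ M₂) (c : V × ℝ → ℝ) :
    ∑ ρ ∈ (X.raise ω M₁ M₂).vt γ, c ρ = ∑ w ∈ X.vt γ.α, X.projWeight ω γ c w := by
  simpa using sum_projWeight_smul hX ω γ c fun _ => (1 : ℝ)

/-- The lower copy of `v` lies one unit under the upper one, so its weight is the depth of the point
under the graph of `raisedHeight`. -/
theorem sum_smul_snd {p : ℕ} {X : SimplexFamily ι V} (hX : X.IsOrderedComplex p)
    (ω : V →ₗ[ℝ] ℝ) {M₁ M₂ : ℤ} (γ : X.RaisedIndex M₁ M₂) (c : V × ℝ → ℝ) :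
    ∑ ρ ∈ (X.raise ω M₁ M₂).vt γ, c ρ * ρ.2 =
      ∑ w ∈ X.vt γ.α, X.projWeight ω γ c w * X.raisedHeight ω γ w
        - c (γ.v, shift ω γ.v + γ.ℓ - 1) := by
  classical
  rw [sum_vt_raise hX]
  simp only [projWeight, add_mul, Finset.sum_add_distrib, ite_mul, zero_mul,
    Finset.sum_ite_eq', γ.v_mem, if_true, raisedHeight_self hX]
  ring

/-- An affine relation projects to a trivial one on the base; the height coordinate then kills the
coefficient of the lower copy of `v`. -/
theorem affineIndependent_raise {p : ℕ} {X : SimplexFamily ι V} (hX : X.IsOrderedComplex p)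
    (ω : V →ₗ[ℝ] ℝ) {M₁ M₂ : ℤ} (γ : X.RaisedIndex M₁ M₂) :
    AffineIndependent ℝ (fun ρ : (X.raise ω M₁ M₂).vt γ => (ρ : V × ℝ)) := by
  classical
  refine affineIndependent_finset_iff.2 fun c h0 h1 => ?_
  have h2 := congrArg Prod.fst h1
  have h3 := congrArg Prod.snd h1
  simp only [Prod.fst_sum, Prod.snd_sum, Prod.smul_fst, Prod.smul_snd, smul_eq_mul, Prod.fst_zero,
    Prod.snd_zero] at h2 h3
  rw [sum_projWeight hX] at h0
  rw [sum_projWeight_smul hX ω γ c fun w => w] at h2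
  have hb := affineIndependent_finset_iff.1 (hX.affineIndependent γ.α) _ h0 h2
  rw [sum_smul_snd hX, Finset.sum_eq_zero fun w hw => by rw [hb w hw, zero_mul], zero_sub,
    neg_eq_zero] at h3
  rintro ⟨w, t⟩ hρ
  rcases (mem_vt_raise hX ω γ).1 hρ with ⟨rfl, rfl⟩ | ⟨hw, rfl⟩
  · exact h3
  · simpa [projWeight, h3] using hb w hw

theorem IsOrderedComplex.raise {p : ℕ} {X : SimplexFamily ι V} (hX : X.IsOrderedComplex p)
    (ω : V →ₗ[ℝ] ℝ) (M₁ M₂ : ℤ) : (X.raise ω M₁ M₂).IsOrderedComplex (p + 1) where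
  finiteDimensional := by
    have := hX.finiteDimensional
    infer_instance
  finrank_eq := by
    have := hX.finiteDimensional
    rw [Module.finrank_prod, hX.finrank_eq, Module.finrank_self]
  card_vt := card_vt_raise hX ω
  affineIndependent := affineIndependent_raise hX ω
  irrefl γ ρ hρ := by
    rintro (h | h)
    · exact hX.irrefl _ _ (fst_mem_of_mem_vt_raise hX ω hρ) h
    · exact lt_irrefl _ h.2
  trans γ := by
    rintro ⟨u, r⟩ hu ⟨v, s⟩ hv ⟨w, t⟩ hw h h'
    have hu := fst_mem_of_mem_vt_raise hX ω hu
    have hv := fst_mem_of_mem_vt_raise hX ω hv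
    have hw := fst_mem_of_mem_vt_raise hX ω hw
    simp only [SimplexFamily.raise] at h h' hu hv hw ⊢
    rcases h with h | ⟨rfl, h⟩ <;> rcases h' with h' | ⟨rfl, h'⟩
    · exact Or.inl (hX.trans _ _ hu _ hv _ hw h h')
    · exact Or.inl h
    · exact Or.inl h'
    · exact Or.inr ⟨rfl, h'.trans h⟩
  total γ := by
    rintro ⟨v, s⟩ hv ⟨w, t⟩ hw hne
    have hv := fst_mem_of_mem_vt_raise hX ω hv
    have hw := fst_mem_of_mem_vt_raise hX ω hw
    simp only [SimplexFamily.raise] at hv hw ⊢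
    by_cases h : v = w
    · subst h
      rcases lt_trichotomy s t with h | rfl | h
      · exact Or.inr (Or.inr ⟨rfl, h⟩)
      · exact absurd rfl hne
      · exact Or.inl (Or.inr ⟨rfl, h⟩)
    · exact (hX.total _ _ hv _ hw h).imp Or.inl Or.inl

/-! ### Fibres of raised simplices -/

/-- Barycentric coordinates on a raised simplex determine those on the base simplex. -/
theorem IsBary.proj {p : ℕ} {X : SimplexFamily ι V} (hX : X.IsOrderedComplex p)
    (ω : V →ₗ[ℝ] ℝ) {M₁ M₂ : ℤ} {γ : X.RaisedIndex M₁ M₂} {c : V × ℝ → ℝ} {y : V × ℝ}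
    (hc : IsBary ((X.raise ω M₁ M₂).vt γ) c y) :
    IsBary (X.vt γ.α) (X.projWeight ω γ c) y.1 where
  nonneg w hw := by
    unfold projWeight
    have h1 := hc.nonneg _ ((mem_vt_raise hX ω γ).2 (Or.inr ⟨hw, rfl⟩))
    have h2 := hc.nonneg _ ((mem_vt_raise hX ω γ).2 (Or.inl ⟨rfl, rfl⟩))
    split_ifs <;> linarith
  sum_eq_one := by rw [← sum_projWeight hX, hc.sum_eq_one]
  sum_smul_eq := by
    rw [← sum_projWeight_smul hX ω γ c fun w => w]
    simpa [Prod.fst_sum] using congrArg Prod.fst hc.sum_smul_eq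

/-- By totality, `1` minus the indicator of `v` preceding `w` is the indicator of `w` preceding or
equalling `v`; averaging produces `below v + b v`. -/
theorem sum_mul_raisedHeight {p : ℕ} {X : SimplexFamily ι V} (hX : X.IsOrderedComplex p)
    (ω : V →ₗ[ℝ] ℝ) {M₁ M₂ : ℤ} {γ : X.RaisedIndex M₁ M₂} {b : V → ℝ} {x : V}
    (hb : IsBary (X.vt γ.α) b x) :
    ∑ w ∈ X.vt γ.α, b w * X.raisedHeight ω γ w =
      ∑ w ∈ X.vt γ.α, b w * shift ω w + γ.ℓ - 1 + X.below ω γ.α b γ.v + b γ.v := by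
  classical
  have h : ∀ w ∈ X.vt γ.α, b w * X.raisedHeight ω γ w = b w * shift ω w + b w * (γ.ℓ - 1)
      + (if X.ltA ω γ.α w γ.v then b w else 0) + if w = γ.v then b w else 0 := by
    intro w hw
    rw [raisedHeight]
    by_cases h1 : w = γ.v
    · subst h1
      have := hX.ltA_irrefl ω γ.v_mem
      simp only [this, if_false, if_true]
      ring
    · rcases hX.ltA_total ω hw γ.v_mem h1 with h2 | h2
      · have h3 : ¬ X.ltA ω γ.α γ.v w := fun h3 =>
          hX.ltA_irrefl ω hw (hX.ltA_trans ω hw γ.v_mem hw h2 h3)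
        simp only [h1, h2, h3, if_false, if_true]
        ring
      · have h3 : ¬ X.ltA ω γ.α w γ.v := fun h3 =>
          hX.ltA_irrefl ω hw (hX.ltA_trans ω hw γ.v_mem hw h3 h2)
        simp only [h1, h2, h3, if_false, if_true]
        ring
  rw [Finset.sum_congr rfl h]
  simp only [Finset.sum_add_distrib, ← Finset.sum_mul, hb.sum_eq_one, Finset.sum_ite_eq',
    γ.v_mem, if_true, below, Finset.sum_filter]
  ring

theorem IsBary.bottom_eq {p : ℕ} {X : SimplexFamily ι V} (hX : X.IsOrderedComplex p)
    (ω : V →ₗ[ℝ] ℝ) {M₁ M₂ : ℤ} {γ : X.RaisedIndex M₁ M₂} {c : V × ℝ → ℝ} {y : V × ℝ}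
    (hc : IsBary ((X.raise ω M₁ M₂).vt γ) c y) {b : V → ℝ} (hb : IsBary (X.vt γ.α) b y.1) :
    c (γ.v, shift ω γ.v + γ.ℓ - 1) =
      X.below ω γ.α b γ.v + b γ.v + γ.ℓ - 1 - (y.2 - ∑ w ∈ X.vt γ.α, b w * shift ω w) := by
  have h1 : ∑ ρ ∈ (X.raise ω M₁ M₂).vt γ, c ρ * ρ.2 = y.2 := by
    simpa [Prod.snd_sum] using congrArg Prod.snd hc.sum_smul_eq
  rw [sum_smul_snd hX, Finset.sum_congr rfl fun w hw => by
    rw [(IsBary.proj hX ω hc).eq (hX.affineIndependent _) hb w hw],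
    sum_mul_raisedHeight hX ω hb] at h1
  linarith

open Classical in
-- The weight `b v` is split between the two copies of `v`: the lower copy receives the distance to
-- the top of the fibre, the upper copy the distance to its bottom.
theorem IsBary.raise {p : ℕ} {X : SimplexFamily ι V} (hX : X.IsOrderedComplex p)
    (ω : V →ₗ[ℝ] ℝ) {M₁ M₂ : ℤ} {γ : X.RaisedIndex M₁ M₂} {b : V → ℝ} {x : V}
    (hb : IsBary (X.vt γ.α) b x) {t : ℝ}
    (h0 : γ.ℓ - 1 + X.below ω γ.α b γ.v ≤ t - ∑ w ∈ X.vt γ.α, b w * shift ω w)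
    (h1 : t - ∑ w ∈ X.vt γ.α, b w * shift ω w ≤ γ.ℓ - 1 + X.below ω γ.α b γ.v + b γ.v) :
    IsBary ((X.raise ω M₁ M₂).vt γ) (fun ρ =>
      if ρ = (γ.v, shift ω γ.v + γ.ℓ - 1) then
        γ.ℓ - 1 + X.below ω γ.α b γ.v + b γ.v - (t - ∑ w ∈ X.vt γ.α, b w * shift ω w)
      else if ρ.1 = γ.v then
        t - ∑ w ∈ X.vt γ.α, b w * shift ω w - (γ.ℓ - 1 + X.below ω γ.α b γ.v)
      else b ρ.1) (x, t) := by
  set c : V × ℝ → ℝ := fun ρ =>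
      if ρ = (γ.v, shift ω γ.v + γ.ℓ - 1) then
        γ.ℓ - 1 + X.below ω γ.α b γ.v + b γ.v - (t - ∑ w ∈ X.vt γ.α, b w * shift ω w)
      else if ρ.1 = γ.v then
        t - ∑ w ∈ X.vt γ.α, b w * shift ω w - (γ.ℓ - 1 + X.below ω γ.α b γ.v)
      else b ρ.1 with hc
  have hbot : c (γ.v, shift ω γ.v + γ.ℓ - 1) =
      γ.ℓ - 1 + X.below ω γ.α b γ.v + b γ.v - (t - ∑ w ∈ X.vt γ.α, b w * shift ω w) := by
    simp only [hc, if_true]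
  have hp : ∀ w, X.projWeight ω γ c w = b w := by
    intro w
    rw [projWeight, hbot]
    by_cases hw : w = γ.v
    · subst hw
      have : (γ.v, X.raisedHeight ω γ γ.v) ≠ (γ.v, shift ω γ.v + γ.ℓ - 1) := by
        rw [raisedHeight_self hX]
        intro h
        linarith [congrArg Prod.snd h]
      simp only [hc, this, if_true, if_false]
      ring
    · simp [hc, hw]
  refine ⟨fun ρ hρ => ?_, ?_, ?_⟩
  · simp only [hc]
    split_ifs
    · linarith
    · linarith
    · exact hb.nonneg _ (fst_mem_of_mem_vt_raise hX ω hρ)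
  · rw [sum_projWeight hX, Finset.sum_congr rfl fun w _ => hp w, hb.sum_eq_one]
  · refine Prod.ext ?_ ?_
    · simp only [Prod.fst_sum, Prod.smul_fst]
      rw [sum_projWeight_smul hX ω γ c fun w => w, Finset.sum_congr rfl fun w _ => by rw [hp w],
        hb.sum_smul_eq]
    · simp only [Prod.snd_sum, Prod.smul_snd, smul_eq_mul]
      rw [sum_smul_snd hX, Finset.sum_congr rfl fun w _ => by rw [hp w],
        sum_mul_raisedHeight hX ω hb, hbot]
      ring

theorem fst_mem_simplex {p : ℕ} {X : SimplexFamily ι V} (hX : X.IsOrderedComplex p)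
    (ω : V →ₗ[ℝ] ℝ) {M₁ M₂ : ℤ} {γ : X.RaisedIndex M₁ M₂} {y : V × ℝ}
    (hy : y ∈ (X.raise ω M₁ M₂).simplex γ) : y.1 ∈ X.simplex γ.α := by
  obtain ⟨c, hc⟩ := mem_simplex_iff.1 hy
  exact mem_simplex_iff.2 ⟨_, IsBary.proj hX ω hc⟩

theorem mem_simplex_raise_iff {p : ℕ} {X : SimplexFamily ι V} (hX : X.IsOrderedComplex p)
    (ω : V →ₗ[ℝ] ℝ) {M₁ M₂ : ℤ} {γ : X.RaisedIndex M₁ M₂} {b : V → ℝ} {x : V}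
    (hb : IsBary (X.vt γ.α) b x) {t : ℝ} :
    (x, t) ∈ (X.raise ω M₁ M₂).simplex γ ↔
      γ.ℓ - 1 + X.below ω γ.α b γ.v ≤ t - ∑ w ∈ X.vt γ.α, b w * shift ω w ∧
      t - ∑ w ∈ X.vt γ.α, b w * shift ω w ≤ γ.ℓ - 1 + X.below ω γ.α b γ.v + b γ.v := by
  classical
  constructor
  · intro h
    obtain ⟨c, hc⟩ := mem_simplex_iff.1 h
    have h1 := IsBary.bottom_eq hX ω hc hb
    have h2 := (IsBary.proj hX ω hc).eq (hX.affineIndependent _) hb γ.v γ.v_mem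
    have h3 := hc.nonneg _ ((mem_vt_raise hX ω γ).2 (Or.inl ⟨rfl, rfl⟩))
    have h4 := hc.nonneg _ ((mem_vt_raise hX ω γ).2 (Or.inr ⟨γ.v_mem, rfl⟩))
    rw [projWeight, if_pos rfl] at h2
    dsimp only at h1
    constructor <;> linarith
  · rintro ⟨h0, h1⟩
    exact mem_simplex_iff.2 ⟨_, IsBary.raise hX ω hb h0 h1⟩

/-! ### Spanning vertices of raised simplices -/

/-- The spanning vertices in a raised simplex, in terms that do not involve the index of the
simplex. -/
theorem mem_spVt_raise_iff {p : ℕ} {X : SimplexFamily ι V} (hX : X.IsOrderedComplex p)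
    (ω : V →ₗ[ℝ] ℝ) {M₁ M₂ : ℤ} {γ : X.RaisedIndex M₁ M₂} {b : V → ℝ} {x : V}
    (hb : IsBary (X.vt γ.α) b x) {t : ℝ} (ht : (x, t) ∈ (X.raise ω M₁ M₂).simplex γ)
    {w : V} {s : ℝ} :
    (w, s) ∈ (X.raise ω M₁ M₂).spVt γ (x, t) ↔
      (w ∈ X.vt γ.α ∧ 0 < b w) ∧ (∃ n : ℤ, s = n) ∧
        s - 1 + ∑ u ∈ X.vt γ.α, b u * X.relShift ω γ.α w u < t ∧
        t < s + b w + ∑ u ∈ X.vt γ.α, b u * X.relShift ω γ.α w u := by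
  classical
  obtain ⟨h0, h1⟩ := (mem_simplex_raise_iff hX ω hb).1 ht
  rw [mem_spVt_iff (affineIndependent_raise hX ω γ) (IsBary.raise hX ω hb h0 h1),
    mem_vt_raise hX, sum_mul_relShift ω hb]
  set σ := t - ∑ w ∈ X.vt γ.α, b w * shift ω w with hσ
  have ht : t = σ + ∑ w ∈ X.vt γ.α, b w * shift ω w := by rw [hσ]; ring
  set G := ∑ w ∈ X.vt γ.α, b w * shift ω w
  have bv := below_nonneg ω hb γ.v
  have bv1 := below_add_le_one hX ω hb γ.v_mem
  have bw := below_nonneg ω hb w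
  obtain ⟨m, hm⟩ := exists_shift_eq ω w
  -- Since the point lies in the slab `ℓ - 1 ≤ σ ≤ ℓ`, the inequalities leave only the integers `m +
  -- ℓ - 1` and `m + ℓ` as heights over `w`.
  have le_of : ∀ n : ℤ, (n : ℝ) < m + γ.ℓ + 1 → (n : ℝ) ≤ m + γ.ℓ := fun n hn => by
    have : n < m + γ.ℓ + 1 := by exact_mod_cast hn
    exact_mod_cast Int.lt_add_one_iff.1 this
  have ge_of : ∀ n : ℤ, (m + γ.ℓ - 1 - 1 : ℝ) < n → (m + γ.ℓ - 1 : ℝ) ≤ n := fun n hn => by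
    have : m + γ.ℓ - 1 - 1 < n := by exact_mod_cast hn
    have : m + γ.ℓ - 1 ≤ n := by omega
    exact_mod_cast this
  have mid : ∀ n : ℤ, (m + γ.ℓ - 1 : ℝ) < n → (m + γ.ℓ : ℝ) ≤ n := fun n hn => by
    have : m + γ.ℓ - 1 < n := by exact_mod_cast hn
    have : m + γ.ℓ ≤ n := by omega
    exact_mod_cast this
  by_cases hv : w = γ.v
  · subst hv
    have hbot : (γ.v, shift ω γ.v + γ.ℓ) ≠ (γ.v, shift ω γ.v + γ.ℓ - 1) := fun h => by
      linarith [congrArg Prod.snd h]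
    rw [raisedHeight_self hX]
    constructor
    · rintro ⟨⟨-, rfl⟩ | ⟨-, rfl⟩, h⟩
      · simp only [if_true] at h
        exact ⟨⟨γ.v_mem, by linarith⟩, ⟨m + γ.ℓ - 1, by rw [hm]; push_cast; ring⟩,
          by linarith, by linarith⟩
      · simp only [hbot, if_false, if_true] at h
        exact ⟨⟨γ.v_mem, by linarith⟩, ⟨m + γ.ℓ, by rw [hm]; push_cast; ring⟩,
          by linarith, by linarith⟩
    · rintro ⟨⟨-, hpos⟩, ⟨n, rfl⟩, h2, h3⟩
      rw [hm] at h2 h3 hbot ⊢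
      have k1 := le_of n (by linarith)
      have k2 := ge_of n (by linarith)
      rcases k2.eq_or_lt with k3 | k3
      · refine ⟨Or.inl ⟨rfl, k3.symm⟩, ?_⟩
        simp only [← k3, if_true]
        linarith
      · have k4 : (n : ℝ) = m + γ.ℓ := le_antisymm k1 (mid n k3)
        refine ⟨Or.inr ⟨γ.v_mem, k4⟩, ?_⟩
        simp only [k4, hbot, if_true, if_false]
        linarith
  · have hne : ∀ s s' : ℝ, (w, s) ≠ (γ.v, s') := fun s s' h => hv (congrArg Prod.fst h)
    simp only [hv, hne, if_false, false_and, false_or]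
    rw [raisedHeight]
    constructor
    · rintro ⟨⟨hw, rfl⟩, hpos⟩
      have bw1 := below_add_le_one hX ω hb hw
      refine ⟨⟨hw, hpos⟩, ?_⟩
      rcases hX.ltA_total ω hw γ.v_mem hv with h | h
      · have h' : ¬ X.ltA ω γ.α γ.v w := fun h' =>
          hX.ltA_irrefl ω hw (hX.ltA_trans ω hw γ.v_mem hw h h')
        have := below_add_le hX ω hb hw γ.v_mem h
        rw [if_neg h']
        exact ⟨⟨m + γ.ℓ, by rw [hm]; push_cast; ring⟩, by linarith, by linarith⟩
      · have := below_add_le hX ω hb γ.v_mem hw h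
        rw [if_pos h]
        exact ⟨⟨m + γ.ℓ - 1, by rw [hm]; push_cast; ring⟩, by linarith, by linarith⟩
    · rintro ⟨⟨hw, hpos⟩, ⟨n, rfl⟩, h2, h3⟩
      have bw1 := below_add_le_one hX ω hb hw
      refine ⟨⟨hw, ?_⟩, hpos⟩
      have bv0 := hb.nonneg γ.v γ.v_mem
      rw [hm] at h2 h3 ⊢
      have k1 := le_of n (by linarith)
      have k2 := ge_of n (by linarith)
      -- For `w ≠ v` exactly one height survives: `σ` lies above the weight interval of `w` if `w`
      -- precedes `v`, and below it otherwise.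
      rcases hX.ltA_total ω hw γ.v_mem hv with h | h
      · have h' : ¬ X.ltA ω γ.α γ.v w := fun h' =>
          hX.ltA_irrefl ω hw (hX.ltA_trans ω hw γ.v_mem hw h h')
        have := below_add_le hX ω hb hw γ.v_mem h
        rw [if_neg h', sub_zero]
        exact le_antisymm k1 (mid n (by linarith))
      · have := below_add_le hX ω hb γ.v_mem hw h
        rw [if_pos h]
        rcases k2.eq_or_lt with k3 | k3
        · exact k3.symm
        · have := mid n k3
          linarith

/-- In `mem_spVt_raise_iff`, the weights and `relShift` averages are `Λ`-invariant, while an integer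
`k` shifts `s` and `t` together. No divisibility of `k` by `M₂ - M₁` is needed. -/
theorem spVt_raise_translate {p : ℕ} {Λ : AddSubgroup V} {X : SimplexFamily ι V}
    (hX : X.IsLambdaComplex p Λ) (ω : V →ₗ[ℝ] ℝ) {M₁ M₂ : ℤ} {γ γ' : X.RaisedIndex M₁ M₂}
    {y : V × ℝ} {l : V} {k : ℤ} (hl : l ∈ Λ)
    (hy : y ∈ (X.raise ω M₁ M₂).simplex γ) (hy' : y + (l, (k : ℝ)) ∈ (X.raise ω M₁ M₂).simplex γ') :
    (X.raise ω M₁ M₂).spVt γ' (y + (l, (k : ℝ))) =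
      (fun v => v + (l, (k : ℝ))) '' (X.raise ω M₁ M₂).spVt γ y := by
  obtain ⟨x, t⟩ := y
  have hO := hX.isOrderedComplex
  have hx := fst_mem_simplex hO ω hy
  have hx' := fst_mem_simplex hO ω hy'
  obtain ⟨b, hb⟩ := mem_simplex_iff.1 hx
  obtain ⟨b', hb'⟩ := mem_simplex_iff.1 hx'
  simp only [Prod.mk_add_mk] at hy' hx' hb' hb ⊢
  have hsp := hX.equivariant γ.α γ'.α x hx _ hx' l hl rfl
  have tr := bary_translate hO.affineIndependent hb hb' hsp
  have hsum : ∀ w ∈ X.vt γ.α, w + l ∈ X.vt γ'.α →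
      ∑ u ∈ X.vt γ'.α, b' u * X.relShift ω γ'.α (w + l) u =
        ∑ u ∈ X.vt γ.α, b u * X.relShift ω γ.α w u := fun w hw hw' =>
    sum_bary_translate hO.affineIndependent hb hb' hsp fun u hu hu' =>
      relShift_translate ω (hX.invariant γ.α γ'.α u w l hl hu hw hu' hw')
  ext ⟨w', s'⟩
  rw [mem_spVt_raise_iff hO ω hb' hy']
  simp only [Set.mem_image, Prod.exists, Prod.mk_add_mk, Prod.mk.injEq]
  constructor
  · rintro ⟨h1, ⟨n, rfl⟩, h2, h3⟩
    have hw' := (mem_spVt_iff (hO.affineIndependent _) hb').2 h1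
    rw [hsp] at hw'
    obtain ⟨w, hw, rfl⟩ := hw'
    obtain ⟨hw, hpos⟩ := (mem_spVt_iff (hO.affineIndependent _) hb).1 hw
    rw [hsum w hw h1.1, (tr w hw hpos).2] at *
    refine ⟨w, n - k, (mem_spVt_raise_iff hO ω hb hy).2
      ⟨⟨hw, hpos⟩, ⟨n - k, by push_cast; ring⟩, by linarith, by linarith⟩, rfl, by ring⟩
  · rintro ⟨w, s, h, rfl, rfl⟩
    obtain ⟨⟨hw, hpos⟩, ⟨n, rfl⟩, h2, h3⟩ := (mem_spVt_raise_iff hO ω hb hy).1 h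
    obtain ⟨hw', hbw⟩ := tr w hw hpos
    rw [hsum w hw hw', hbw]
    exact ⟨⟨hw', hpos⟩, ⟨n + k, by push_cast; ring⟩, by linarith, by linarith⟩

/-- Equivariance of the spanning vertices implies that simplices meet along common faces. -/
theorem simplex_inter_of_spVt_eq {X : SimplexFamily ι V} {α β : ι}
    (hX : AffineIndependent ℝ (fun v : X.vt α => (v : V)))
    (h : ∀ x ∈ X.simplex α, x ∈ X.simplex β → X.spVt β x = X.spVt α x) :
    X.simplex α ∩ X.simplex β = convexHull ℝ ((X.vt α : Set V) ∩ (X.vt β : Set V)) := by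
  refine Set.Subset.antisymm ?_ (Set.subset_inter (convexHull_mono Set.inter_subset_left)
    (convexHull_mono Set.inter_subset_right))
  rintro x ⟨hα, hβ⟩
  obtain ⟨b, hb⟩ := mem_simplex_iff.1 hα
  have hsub : X.spVt α x ⊆ (X.vt α : Set V) ∩ (X.vt β : Set V) := by
    refine Set.subset_inter (fun v hv => hv.1) ?_
    rw [← h x hα hβ]
    exact fun v hv => hv.1
  exact convexHull_mono hsub (mem_convexHull_spVt hX hb)

/-! ### Covering and injectivity modulo the lattice -/

theorem fst_mem_interior_simplex {p : ℕ} {X : SimplexFamily ι V} (hX : X.IsOrderedComplex p)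
    (ω : V →ₗ[ℝ] ℝ) {M₁ M₂ : ℤ} {γ : X.RaisedIndex M₁ M₂} {y : V × ℝ}
    (hy : y ∈ interior ((X.raise ω M₁ M₂).simplex γ)) : y.1 ∈ interior (X.simplex γ.α) := by
  refine interior_maximal ?_ (isOpenMap_fst _ isOpen_interior) (Set.mem_image_of_mem _ hy)
  rintro _ ⟨z, hz, rfl⟩
  exact fst_mem_simplex hX ω (interior_subset hz)

/-- The vertical coordinate of interior points of raised simplices is strictly bounded. -/
theorem snd_mem_Ioo_of_mem_interior {p : ℕ} {X : SimplexFamily ι V} (hX : X.IsOrderedComplex p)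
    (ω : V →ₗ[ℝ] ℝ) {M₁ M₂ : ℤ} {γ : X.RaisedIndex M₁ M₂} {b : V → ℝ} {x : V} {t : ℝ}
    (hb : IsBary (X.vt γ.α) b x)
    (hy : (x, t) ∈ interior ((X.raise ω M₁ M₂).simplex γ)) :
    t - ∑ w ∈ X.vt γ.α, b w * shift ω w ∈ Set.Ioo (M₁ - 1 : ℝ) (M₂ - 1) := by
  have hU : ((fun s : ℝ => (x, s)) ⁻¹' interior ((X.raise ω M₁ M₂).simplex γ)) ∈ nhds t :=
    (isOpen_interior.preimage (by fun_prop)).mem_nhds hy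
  obtain ⟨ε, hε, hball⟩ := Metric.mem_nhds_iff.1 hU
  -- Moving slightly up and down inside the fibre turns its closed bounds into strict ones.
  have h1 := interior_subset (@hball (t + ε / 2) (by
    rw [Metric.mem_ball, Real.dist_eq, add_sub_cancel_left, abs_of_pos (by linarith)]; linarith))
  have h2 := interior_subset (@hball (t - ε / 2) (by
    rw [Metric.mem_ball, Real.dist_eq, sub_sub_cancel_left, abs_neg, abs_of_pos (by linarith)]
    linarith))
  have h1 := (mem_simplex_raise_iff hX ω hb).1 h1
  have h2 := (mem_simplex_raise_iff hX ω hb).1 h2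
  have b0 := below_nonneg ω hb γ.v
  have b1 := below_add_le_one hX ω hb γ.v_mem
  have l0 : (M₁ : ℝ) ≤ γ.ℓ := by exact_mod_cast γ.le_ℓ
  have l1 : (γ.ℓ : ℝ) + 1 ≤ M₂ := by exact_mod_cast γ.ℓ_lt
  constructor <;> linarith

theorem surjOn_raise {p : ℕ} {Λ : AddSubgroup V} {X : SimplexFamily ι V}
    (hX : X.IsLambdaComplex p Λ) (ω : V →ₗ[ℝ] ℝ) {M₁ M₂ : ℤ} (hM : M₁ < M₂) :
    Set.SurjOn (QuotientAddGroup.mk : V × ℝ →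
        (V × ℝ) ⧸ Λ.prod (AddSubgroup.zmultiples ((M₂ : ℝ) - M₁)))
      (X.raise ω M₁ M₂).pointSet Set.univ := by
  classical
  intro q _
  obtain ⟨⟨x, t⟩, rfl⟩ := QuotientAddGroup.mk_surjective q
  obtain ⟨s, hs, hsx⟩ := hX.surjOn (Set.mem_univ (x : V ⧸ Λ))
  obtain ⟨α, hα⟩ := Set.mem_iUnion.1 hs
  obtain ⟨b, hb⟩ := mem_simplex_iff.1 hα
  have hO := hX.isOrderedComplex
  have hD : (0 : ℝ) < M₂ - M₁ := sub_pos.2 (by exact_mod_cast hM)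
  set G := ∑ w ∈ X.vt α, b w * shift ω w with hG
  -- Moves the height into `[G + M₁ - 1, G + M₂ - 1)`, the part of the fibre covered by the raised
  -- simplices.
  obtain ⟨k, ⟨hk1, hk2⟩, -⟩ := existsUnique_add_zsmul_mem_Ico hD t (G + M₁ - 1)
  set t' := t + k • ((M₂ : ℝ) - M₁) with ht'
  obtain ⟨v, hv, hv1, hv2⟩ := exists_partial_sum_interval (S := X.vt α) (r := X.ltA ω α)
    (fun v hv => hO.ltA_irrefl ω hv) (fun u hu v hv w hw => hO.ltA_trans ω hu hv hw)
    (fun v hv w hw => hO.ltA_total ω hv hw) hb.nonneg hb.sum_eq_one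
    (Int.fract_nonneg (t' - G)) (Int.fract_lt_one (t' - G)).le
  have hf := Int.floor_add_fract (t' - G)
  -- The level is the floor plus one because level `ℓ` fills `[ℓ - 1, ℓ]`; the fractional part has
  -- selected `v`.
  refine ⟨(s, t'), Set.mem_iUnion.2 ⟨⟨α, v, ⌊t' - G⌋ + 1, hv, ?_, ?_⟩, ?_⟩, ?_⟩
  · have : M₁ - 1 ≤ ⌊t' - G⌋ := Int.le_floor.2 (by push_cast; linarith)
    linarith
  · have : ⌊t' - G⌋ < M₂ - 1 := Int.floor_lt.2 (by push_cast; linarith)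
    linarith
  · refine (mem_simplex_raise_iff hO ω hb).2 ?_
    simp only [below, ← hG]
    push_cast
    constructor <;> linarith
  · rw [QuotientAddGroup.eq] at hsx ⊢
    refine ⟨hsx, AddSubgroup.mem_zmultiples_iff.2 ⟨-k, ?_⟩⟩
    simp only [ht', Prod.snd_add, Prod.snd_neg, neg_smul]
    ring

theorem injOn_raise {p : ℕ} {Λ : AddSubgroup V} {X : SimplexFamily ι V}
    (hX : X.IsLambdaComplex p Λ) (ω : V →ₗ[ℝ] ℝ) {M₁ M₂ : ℤ} :
    Set.InjOn (QuotientAddGroup.mk : V × ℝ →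
        (V × ℝ) ⧸ Λ.prod (AddSubgroup.zmultiples ((M₂ : ℝ) - M₁)))
      (⋃ γ, interior ((X.raise ω M₁ M₂).simplex γ)) := by
  rintro ⟨x, t⟩ hy ⟨x', t'⟩ hy' h
  obtain ⟨γ, hγ⟩ := Set.mem_iUnion.1 hy
  obtain ⟨γ', hγ'⟩ := Set.mem_iUnion.1 hy'
  have hO := hX.isOrderedComplex
  have hx := fst_mem_interior_simplex hO ω hγ
  have hx' := fst_mem_interior_simplex hO ω hγ'
  obtain ⟨hl, hk⟩ := QuotientAddGroup.eq.1 h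
  obtain rfl : x = x' := hX.injOn (Set.mem_iUnion.2 ⟨_, hx⟩) (Set.mem_iUnion.2 ⟨_, hx'⟩)
    (QuotientAddGroup.eq.2 hl)
  have hx := interior_subset hx
  have hx' := interior_subset hx'
  obtain ⟨b, hb⟩ := mem_simplex_iff.1 hx
  obtain ⟨b', hb'⟩ := mem_simplex_iff.1 hx'
  -- Equivariance at `l = 0` shows that both base simplices give the same `G`. Both heights then lie
  -- in one open interval of length `M₂ - M₁`, so they cannot differ by a nonzero multiple of it.
  have hsp := hX.equivariant γ.α γ'.α x hx (x + 0) (by simpa using hx') 0 Λ.zero_mem rfl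
  have hsum := sum_bary_translate hO.affineIndependent hb (by simpa using hb') hsp
    (F := shift ω) (F' := shift ω) (fun w _ _ => by rw [add_zero])
  have h1 := snd_mem_Ioo_of_mem_interior hO ω hb hγ
  have h2 := snd_mem_Ioo_of_mem_interior hO ω hb' hγ'
  rw [hsum] at h2
  obtain ⟨k, hk⟩ := AddSubgroup.mem_zmultiples_iff.1 hk
  simp only [Prod.snd_add, Prod.snd_neg, zsmul_eq_mul] at hk
  have hD : (0 : ℝ) < M₂ - M₁ := by linarith [h1.1, h1.2]
  have k1 : (k : ℝ) < 1 := by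
    by_contra! hc
    nlinarith [h1.1, h1.2, h2.1, h2.2]
  have k2 : (-1 : ℝ) < k := by
    by_contra! hc
    nlinarith [h1.1, h1.2, h2.1, h2.2]
  have k0 : k = 0 := by
    have : k < 1 := by exact_mod_cast k1
    have : -1 < k := by exact_mod_cast k2
    omega
  rw [k0, Int.cast_zero, zero_mul] at hk
  exact Prod.ext rfl (by dsimp only; linarith)

/-! ### The raised family as a complex for the product lattice -/

theorem IsLambdaComplex.raise {p : ℕ} {Λ : AddSubgroup V} {X : SimplexFamily ι V}
    (hX : X.IsLambdaComplex p Λ) (ω : V →ₗ[ℝ] ℝ) {M₁ M₂ : ℤ} (hM : M₁ < M₂) :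
    (X.raise ω M₁ M₂).IsLambdaComplex (p + 1)
      (Λ.prod (AddSubgroup.zmultiples ((M₂ : ℝ) - (M₁ : ℝ)))) := by
  have hO := hX.isOrderedComplex
  have invariant : ∀ γ γ', ∀ v w : V × ℝ,
      ∀ l ∈ Λ.prod (AddSubgroup.zmultiples ((M₂ : ℝ) - (M₁ : ℝ))),
      v ∈ (X.raise ω M₁ M₂).vt γ → w ∈ (X.raise ω M₁ M₂).vt γ →
      v + l ∈ (X.raise ω M₁ M₂).vt γ' → w + l ∈ (X.raise ω M₁ M₂).vt γ' →
      ((X.raise ω M₁ M₂).lt γ v w ↔ (X.raise ω M₁ M₂).lt γ' (v + l) (w + l)) := by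
    intro γ γ' v w l hl hv hw hv' hw'
    have := hX.invariant γ.α γ'.α v.1 w.1 l.1 hl.1 (fst_mem_of_mem_vt_raise hO ω hv)
      (fst_mem_of_mem_vt_raise hO ω hw) (fst_mem_of_mem_vt_raise hO ω hv')
      (fst_mem_of_mem_vt_raise hO ω hw')
    simp only [SimplexFamily.raise, this, Prod.fst_add, Prod.snd_add, add_left_inj,
      add_lt_add_iff_right]
  have equivariant : ∀ γ γ', ∀ x ∈ (X.raise ω M₁ M₂).simplex γ,
      ∀ x' ∈ (X.raise ω M₁ M₂).simplex γ',
      ∀ l ∈ Λ.prod (AddSubgroup.zmultiples ((M₂ : ℝ) - (M₁ : ℝ))), x' = x + l →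
      (X.raise ω M₁ M₂).spVt γ' x' = (fun v => v + l) '' (X.raise ω M₁ M₂).spVt γ x := by
    rintro γ γ' x hx _ hx' ⟨l, r⟩ ⟨hl, hr⟩ rfl
    obtain ⟨k, rfl⟩ := AddSubgroup.mem_zmultiples_iff.1 hr
    have e : k • ((M₂ : ℝ) - M₁) = ((k * (M₂ - M₁) : ℤ) : ℝ) := by
      push_cast
      rw [zsmul_eq_mul]
    simp only [e] at hx' ⊢
    exact spVt_raise_translate hX ω hl hx hx'
  have hD : (M₂ : ℝ) - M₁ ≠ 0 := sub_ne_zero.2 (by exact_mod_cast hM.ne')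
  refine ⟨isFullLattice_prod hX.isFullLattice hD, hO.raise ω M₁ M₂, fun γ γ' => Or.inr ?_,
    fun γ γ' v w hv hv' hw hw' => ?_, invariant, surjOn_raise hX ω hM, injOn_raise hX ω,
    equivariant⟩
  · refine simplex_inter_of_spVt_eq (affineIndependent_raise hO ω γ) fun x hx hx' => ?_
    simpa using equivariant γ γ' x hx x hx' 0 (zero_mem _) (add_zero x).symm
  · simpa using invariant γ γ' v w 0 (zero_mem _) hv hw (by simpa using hv') (by simpa using hw')

/-! ### Bounds for the height plus `ω` -/

/-- At a vertex over `w` the quantity is `A w + ℓ` or `A w + ℓ - 1`. The first occurs only if `A w ≤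
A v`, the second only if `A v ≤ A w`; the remaining bounds follow from `0 < A ≤ 1`. -/
theorem raise_vertex_bounds {p : ℕ} {X : SimplexFamily ι V} (hX : X.IsOrderedComplex p)
    (ω : V →ₗ[ℝ] ℝ) {M₁ M₂ : ℤ} {γ : X.RaisedIndex M₁ M₂} {ρ : V × ℝ}
    (hρ : ρ ∈ (X.raise ω M₁ M₂).vt γ) :
    upperFract ω γ.v + γ.ℓ - 1 ≤ ω ρ.1 + ρ.2 ∧ ω ρ.1 + ρ.2 ≤ upperFract ω γ.v + γ.ℓ := by
  classical
  obtain ⟨w, t⟩ := ρ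
  have v0 := upperFract_pos ω γ.v
  have v1 := upperFract_le_one ω γ.v
  have w0 := upperFract_pos ω w
  have w1 := upperFract_le_one ω w
  rcases (mem_vt_raise hX ω γ).1 hρ with ⟨rfl, rfl⟩ | ⟨hw, rfl⟩
  · simp only [shift]
    constructor <;> linarith
  · simp only [raisedHeight, shift]
    split_ifs with h
    · have : upperFract ω γ.v ≤ upperFract ω w := h.elim le_of_lt fun h => h.1.le
      constructor <;> linarith
    · have : upperFract ω w ≤ upperFract ω γ.v := not_lt.1 fun h' => h (Or.inl h')
      constructor <;> linarith

theorem raise_bounds {p : ℕ} {X : SimplexFamily ι V} (hX : X.IsOrderedComplex p)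
    (ω : V →ₗ[ℝ] ℝ) {M₁ M₂ : ℤ} {γ : X.RaisedIndex M₁ M₂} {κ : V × ℝ}
    (hκ : κ ∈ (X.raise ω M₁ M₂).simplex γ) :
    upperFract ω γ.v + γ.ℓ - 1 ≤ ω κ.1 + κ.2 ∧ ω κ.1 + κ.2 ≤ upperFract ω γ.v + γ.ℓ := by
  have hconv : Convex ℝ ((ω.coprod LinearMap.id) ⁻¹'
      Set.Icc (upperFract ω γ.v + γ.ℓ - 1) (upperFract ω γ.v + γ.ℓ)) :=
    (convex_Icc _ _).linear_preimage _
  have := convexHull_min (fun ρ hρ => ?_) hconv hκ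
  · simpa using this
  · simpa using raise_vertex_bounds hX ω hρ

end SimplexFamily

theorem proposition1 {V : Type*} [NormedAddCommGroup V] [NormedSpace ℝ V] {ι : Type*}
    (p : ℕ) (Λ : AddSubgroup V) (X : SimplexFamily ι V) (hX : X.IsLambdaComplex p Λ)
    (M₁ M₂ : ℤ) (hM : M₁ < M₂) (ω : V →ₗ[ℝ] ℝ) :
    (X.raise ω M₁ M₂).IsLambdaComplex (p + 1)
        (Λ.prod (AddSubgroup.zmultiples ((M₂ : ℝ) - (M₁ : ℝ)))) ∧
      ∀ γ : X.RaisedIndex M₁ M₂, ∀ κ ∈ (X.raise ω M₁ M₂).simplex γ,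
        SimplexFamily.upperFract ω γ.v + γ.ℓ - 1 ≤ ω κ.1 + κ.2 ∧
          ω κ.1 + κ.2 ≤ SimplexFamily.upperFract ω γ.v + γ.ℓ :=
  ⟨hX.raise ω hM, fun _ _ hκ => SimplexFamily.raise_bounds hX.isOrderedComplex ω hκ⟩
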